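/- Let $(V,g)$ be a Euclidean real vector space of finite dimension $n$, and let $\mathcal D=\Lambda V^*\otimes\Lambda V^*=\bigoplus_{p,q\ge 0}\mathcal D^{p,q}$, $\mathcal D^{p,q}=\Lambda^pV^*\otimes\Lambda^qV^*$, be the algebra of double forms, with product $(\theta_1\otimes\theta_2)(\theta_3\otimes\theta_4)=(\theta_1\wedge\theta_3)\otimes(\theta_2\wedge\theta_4)$; $\mathcal D^{0,0}$ is identified with $\mathbb R$, and $g$ is regarded as an element of $\mathcal D^{1,1}$. A $(p,q)$ double form is an element of $\mathcal D^{p,q}$, viewed also as a bilinear form on $\Lambda^pV\times\Lambda^qV$. Let $\langle\cdot,\cdot\rangle$ be the inner product on $\mathcal D$ with $\langle\theta_1\otimes\theta_2,\theta_3\otimes\theta_4\rangle=\langle\theta_1,\theta_3\rangle\langle\theta_2,\theta_4\rangle$, where $\Lambda V^*$ carries the inner product induced by $g$. Let $*$ be the double Hodge star operator, $*(\theta_1\otimes\theta_2)=(*\theta_1)\otimes(*\theta_2)$ (independent of the orientation of $V$), and let $c$ be the contraction map, $c\,\omega(x,y)=\sum_{i=1}^n\omega(e_i\wedge x,e_i\wedge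 y)$ for any orthonormal basis $(e_i)$ of $V$ (with $c\,\omega=0$ on $\mathcal D^{p,q}$ if $p=0$ or $q=0$). Let $p\ge 0$ and $q\ge 1$ be integers with $n\ge 2pq$, and let $\omega$ be a $(p,p)$ double form that is symmetric, $\omega(x,y)=\omega(y,x)$, and satisfies the first Bianchi identity $$\sum_{j=1}^{p+1}(-1)^j\,\omega(x_1\wedge\dots\wedge\widehat{x_j}\wedge\dots\wedge x_{p+1},\;x_j\wedge y_1\wedge\dots\wedge y_{p-1})=0$$ for all $x_1,\dots,x_{p+1},y_1,\dots,y_{p-1}\in V$ (no condition if $p=0$). Put $$h_{(pq,pq)}(\omega)=*\,\frac{g^{\,n-2pq}\,\omega^q}{(n-2pq)!}\in\mathcal D^{pq,pq}.$$ Then $$\frac{c^{2pq}(\omega^{2q})}{(2pq)!}=\langle h_{(pq,pq)}(\omega),\omega^q\rangle=\sum_{r=0}^{pq}\frac{(-1)^{r+pq}}{(r!)^2}\,\langle c^r\omega^q,\,c^r\omega^q\rangle .$$ -/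

import Mathlib

open scoped TensorProduct

noncomputable section

namespace DoubleForm

/-! ### Exterior forms on a Euclidean vector space -/

section Forms

variable (V : Type*) [NormedAddCommGroup V] [InnerProductSpace ℝ V] [FiniteDimensional ℝ V]

/-- The exterior algebra `ΛV*` of the dual of `V`. -/
abbrev Forms : Type _ := ExteriorAlgebra ℝ (Module.Dual ℝ V)

/-- The musical isomorphism `V* → V`: `sharp f` is the vector with `⟪sharp f, v⟫ = f v`. -/
def sharp : Module.Dual ℝ V →ₗ[ℝ] V :=
  ∑ i, (Module.Dual.eval ℝ V (stdOrthonormalBasis ℝ V i)).smulRight (stdOrthonormalBasis ℝ V i)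

theorem inner_sharp (f : Module.Dual ℝ V) (v : V) : inner ℝ (sharp V f) v = f v := by
  conv_rhs => rw [← (stdOrthonormalBasis ℝ V).sum_repr' v]
  simp [sharp, sum_inner, inner_smul_left, mul_comm]

/-- The degree `k` component of an element of an exterior algebra. -/
def component {M : Type*} [AddCommGroup M] [Module ℝ M] (k : ℕ) :
    ExteriorAlgebra ℝ M →ₗ[ℝ] ⋀[ℝ]^k M :=
  DirectSum.component ℝ ℕ (fun i => ⋀[ℝ]^i M) k ∘ₗ
    (DirectSum.decomposeLinearEquiv (fun i : ℕ => ⋀[ℝ]^i M)).toLinearMap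

/-- The inner product on `ΛV*`: forms of different degrees are orthogonal, and on `k`-forms
`⟨θ₁, θ₂⟩` is the inner product of the dual `k`-vectors in `⋀^k V`. (There are no nonzero
`k`-vectors for `k > dim V`.) -/
def formInner : LinearMap.BilinForm ℝ (Forms V) :=
  ∑ k ∈ Finset.range (Module.finrank ℝ V + 1),
    (innerₗ (⋀[ℝ]^k V)).compl₁₂
      (component k ∘ₗ (ExteriorAlgebra.map (sharp V)).toLinearMap)
      (component k ∘ₗ (ExteriorAlgebra.map (sharp V)).toLinearMap)

variable {V}

/-- The value `θ(v₁, …, v_k)` of the degree `k` component of a form on `v₁ ∧ ⋯ ∧ v_k`, so that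
`(f₁ ∧ ⋯ ∧ f_k)(v₁, …, v_k) = det (f_j (v_i))`. -/
def formEval {k : ℕ} (v : Fin k → V) : Forms V →ₗ[ℝ] ℝ :=
  (exteriorPower.pairingDual ℝ V k).flip (exteriorPower.ιMulti ℝ k v) ∘ₗ component k

/-- Interior product of forms with a vector: `(ι_v θ)(v₂, …, v_k) = θ(v, v₂, …, v_k)`. -/
def interior (v : V) : Forms V →ₗ[ℝ] Forms V :=
  CliffordAlgebra.contractLeft (Q := (0 : QuadraticForm ℝ (Module.Dual ℝ V)))
    (Module.Dual.eval ℝ V v)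

variable (V) in
/-- Interior product of forms with multivectors,
`v₁ ∧ ⋯ ∧ v_k ↦ ι_{v₁} ∘ ⋯ ∘ ι_{v_k}`. -/
def interiorMulti : ExteriorAlgebra ℝ V →ₐ[ℝ] Module.End ℝ (Forms V) :=
  ExteriorAlgebra.lift ℝ
    ⟨(CliffordAlgebra.contractLeft (Q := (0 : QuadraticForm ℝ (Module.Dual ℝ V)))) ∘ₗ
        Module.Dual.eval ℝ V,
      fun v => LinearMap.ext fun x =>
        CliffordAlgebra.contractLeft_contractLeft (Module.Dual.eval ℝ V v) x⟩

/-- The volume form `e₁* ∧ ⋯ ∧ e_n*` of the orientation given by an orthonormal basis. -/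
def volumeForm {n : ℕ} (e : OrthonormalBasis (Fin n) ℝ V) : Forms V :=
  ExteriorAlgebra.ιMulti ℝ n fun i => innerₗ V (e i)

/-- The Hodge star operator on `ΛV*` for the orientation given by `e`:
`*(f₁ ∧ ⋯ ∧ f_k) = ι_{f_k♯} ⋯ ι_{f₁♯} vol`. It is characterized by
`α ∧ *β = ⟨α, β⟩ vol` for `k`-forms `α`, `β`. -/
def formStar {n : ℕ} (e : OrthonormalBasis (Fin n) ℝ V) : Forms V →ₗ[ℝ] Forms V :=
  (interiorMulti V).toLinearMap.flip (volumeForm e) ∘ₗ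
    CliffordAlgebra.reverse (Q := (0 : QuadraticForm ℝ V)) ∘ₗ
      (ExteriorAlgebra.map (sharp V)).toLinearMap

end Forms

/-! ### The algebra of double forms -/

section DoubleForms

variable (V : Type*) [NormedAddCommGroup V] [InnerProductSpace ℝ V] [FiniteDimensional ℝ V]

/-- The algebra `D = ΛV* ⊗ ΛV*` of double forms, with the exterior product
`(θ₁ ⊗ θ₂)(θ₃ ⊗ θ₄) = (θ₁ ∧ θ₃) ⊗ (θ₂ ∧ θ₄)`. -/
abbrev _root_.DoubleForm : Type _ := Forms V ⊗[ℝ] Forms V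

/-- The space `D^{p,q} = Λ^p V* ⊗ Λ^q V*` of `(p,q)` double forms. -/
def bidegree (p q : ℕ) : Submodule ℝ (DoubleForm V) :=
  LinearMap.range
    (TensorProduct.mapIncl (⋀[ℝ]^p (Module.Dual ℝ V)) (⋀[ℝ]^q (Module.Dual ℝ V)))

/-- The metric `g`, as a `(1,1)` double form: `g = ∑ e_i* ⊗ e_i*`. -/
def metric : DoubleForm V :=
  TensorProduct.map (ExteriorAlgebra.ι ℝ ∘ₗ innerₗ V) (ExteriorAlgebra.ι ℝ ∘ₗ innerₗ V)
    (InnerProductSpace.canonicalCovariantTensor V)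

/-- The inner product of double forms,
`⟨θ₁ ⊗ θ₂, θ₃ ⊗ θ₄⟩ = ⟨θ₁, θ₃⟩ ⟨θ₂, θ₄⟩`. -/
def innerProduct : LinearMap.BilinForm ℝ (DoubleForm V) :=
  (formInner V).tmul (formInner V)

/-- The contraction map `c`: `(c ω)(x, y) = ∑ ω(e_i ∧ x, e_i ∧ y)`. -/
def contraction : DoubleForm V →ₗ[ℝ] DoubleForm V :=
  ∑ i, TensorProduct.map (interior (stdOrthonormalBasis ℝ V i))
    (interior (stdOrthonormalBasis ℝ V i))

/-- The double Hodge star operator `*(θ₁ ⊗ θ₂) = *θ₁ ⊗ *θ₂`; on a `(p,q)` double form this is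
`(*ω)(u, v) = (-1)^((p+q)(n-p-q)) ω(*u, *v)`, since `(*θ)(u) = (-1)^(p(n-p)) θ(*u)` for a
`p`-form `θ`. It does not depend on the orientation, since the Hodge star operator of `ΛV*` is
applied twice. -/
def hodgeStar : DoubleForm V →ₗ[ℝ] DoubleForm V :=
  TensorProduct.map (formStar (stdOrthonormalBasis ℝ V)) (formStar (stdOrthonormalBasis ℝ V))

variable {V}

/-- The contraction map can be computed in any orthonormal basis. -/
theorem contraction_eq_sum {ι : Type*} [Fintype ι] (e : OrthonormalBasis ι ℝ V) :
    contraction V = ∑ i, TensorProduct.map (interior (e i)) (interior (e i)) := by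
  let L : V →ₗ[ℝ] Module.End ℝ (Forms V) :=
    CliffordAlgebra.contractLeft (Q := (0 : QuadraticForm ℝ (Module.Dual ℝ V))) ∘ₗ
      Module.Dual.eval ℝ V
  let T := TensorProduct.lift ((TensorProduct.mapBilinear (RingHom.id ℝ) (Forms V) (Forms V) (Forms V) (Forms V)).compl₁₂ L L)
  have := congrArg T ((InnerProductSpace.canonicalCovariantTensor_eq_sum V
    (stdOrthonormalBasis ℝ V)).symm.trans (InnerProductSpace.canonicalCovariantTensor_eq_sum V e))
  simp only [map_sum] at this
  exact this

/-- The metric can be computed in any orthonormal basis. -/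
theorem metric_eq_sum {ι : Type*} [Fintype ι] (e : OrthonormalBasis ι ℝ V) :
    metric V = ∑ i, ExteriorAlgebra.ι ℝ (innerₗ V (e i)) ⊗ₜ[ℝ] ExteriorAlgebra.ι ℝ (innerₗ V (e i)) := by
  simp [metric, InnerProductSpace.canonicalCovariantTensor_eq_sum V e]

/-- The volume form depends on the orthonormal basis only up to a sign. -/
theorem volumeForm_eq {n : ℕ} (e e' : OrthonormalBasis (Fin n) ℝ V) :
    volumeForm e' = volumeForm e ∨ volumeForm e' = - volumeForm e := by
  have key : (ExteriorAlgebra.ιMulti ℝ n).compLinearMap (innerₗ V : V →ₗ[ℝ] Module.Dual ℝ V) =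
      (LinearMap.toSpanSingleton ℝ (Forms V) (volumeForm e)).compAlternatingMap e.toBasis.det := by
    refine Module.Basis.ext_alternating e.toBasis fun i hi => ?_
    have hb : Function.Bijective i := Finite.injective_iff_bijective.mp hi
    let σ := Equiv.ofBijective i hb
    have hs : (fun j => e.toBasis (i j)) = e.toBasis ∘ σ := rfl
    rw [hs, AlternatingMap.map_perm, AlternatingMap.map_perm]
    have hd : e.toBasis.det e = 1 := by
      simpa using e.toBasis.det_self
    simp [volumeForm, hd]
    try rfl
  have h := congrArg (fun F => F e') key
  have h2 : volumeForm e' = e.toBasis.det e' • volumeForm e := by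
    simpa [volumeForm] using h
  rcases e.det_to_matrix_orthonormalBasis_real e' with h3 | h3
  · left; rw [h2, h3, one_smul]
  · right; rw [h2, h3, neg_one_smul]

/-- The double Hodge star operator can be computed in any orthonormal basis. -/
theorem hodgeStar_eq {n : ℕ} (e : OrthonormalBasis (Fin n) ℝ V) :
    hodgeStar V = TensorProduct.map (formStar e) (formStar e) := by
  obtain rfl : n = Module.finrank ℝ V := by simpa using (Module.finrank_eq_card_basis e.toBasis).symm
  rcases volumeForm_eq e (stdOrthonormalBasis ℝ V) with h | h
  · simp [hodgeStar, formStar, h]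
  · rw [hodgeStar, formStar, h, formStar]
    ext x y
    simp [TensorProduct.neg_tmul, TensorProduct.tmul_neg]

/-- The value `ω(x₁ ∧ ⋯ ∧ x_p, y₁ ∧ ⋯ ∧ y_q)` of (the `(p,q)` component of) a double form. -/
def eval {p q : ℕ} (ω : DoubleForm V) (x : Fin p → V) (y : Fin q → V) : ℝ :=
  LinearMap.mul' ℝ ℝ (TensorProduct.map (formEval x) (formEval y) ω)

/-- A double form is symmetric if it equals its transpose, `(θ₁ ⊗ θ₂)ᵗ = θ₂ ⊗ θ₁`. -/
def IsSymmetric (ω : DoubleForm V) : Prop :=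
  TensorProduct.comm ℝ (Forms V) (Forms V) ω = ω

/-- The first Bianchi identity for a `(p,q)` double form: for all `x₁, …, x_{p+1}` and
`y₁, …, y_{q-1}`,
`∑_j (-1)^j ω(x₁ ∧ ⋯ ∧ x̂_j ∧ ⋯ ∧ x_{p+1}, x_j ∧ y₁ ∧ ⋯ ∧ y_{q-1}) = 0`
(no condition if `q = 0`). -/
def FirstBianchi (p q : ℕ) (ω : DoubleForm V) : Prop :=
  ∀ m : ℕ, q = m + 1 → ∀ (x : Fin (p + 1) → V) (y : Fin m → V),
    ∑ j : Fin (p + 1), (-1 : ℝ) ^ ((j : ℕ) + 1) *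
      eval ω (fun i => x (j.succAbove i)) (Fin.cons (x j) y : Fin (m + 1) → V) = 0

/-- The cofactor transformation
`h_{(r,pq)}(ω) = *(g^{n-pq-r} ω^q) / (n-pq-r)!` of order `(r, pq)` of a `(p,p)` double form,
where `n = dim V`; it is meant for `0 ≤ r ≤ n - pq`. -/
def cofactor (r p q : ℕ) (ω : DoubleForm V) : DoubleForm V :=
  ((Module.finrank ℝ V - p * q - r).factorial : ℝ)⁻¹ •
    hodgeStar V (metric V ^ (Module.finrank ℝ V - p * q - r) * ω ^ q)

end DoubleForms

end DoubleForm

end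

noncomputable section

set_option linter.unusedSectionVars false

namespace DoubleForm

variable {V : Type*} [NormedAddCommGroup V] [InnerProductSpace ℝ V] [FiniteDimensional ℝ V]

/-! ### Interior products of forms with forms -/

/-! All three quantities equal `pairing (ω ^ q * ω ^ q)`, where `pairing` is the full contraction θ
⊗ η ↦ ⟨θ, η⟩.

For X of bidegree (m, m), c^m X is the scalar m! · `pairing X` (`contraction_pow_eq_algebraMap`);
this gives the left-hand side.

For the cofactor, *X is the interior product of X with vol ⊗ vol, and multiplication by g is adjoint
to c. Hence ⟨*(g^k X), Y⟩ = ⟨XY, c^k(vol ⊗ vol)⟩, which is k! · `pairing (X * Y)` because the Hodge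
star is an isometry (`innerProduct_contraction_pow_volumeForm`).

For the sum, `pairing_mul_comm` computes ⟨α ∧ α', β ∧ β'⟩ = ⟨β', ι_β(α ∧ α')⟩ by moving ι_β past α.
The correction terms are the contractions c^r(α ⊗ β), each with a factor 1/r!
(`interiorForm_mul_eq_sum`). Pairing them with β' ⊗ α' gives c^r(β' ⊗ α') and the second 1/r!. The
transpose in that formula is absorbed by the symmetry of ω^q. -/

@[simp]
theorem interior_one (v : V) : interior v (1 : Forms V) = 0 :=
  CliffordAlgebra.contractLeft_one _ _

@[simp]
theorem interior_algebraMap (v : V) (r : ℝ) : interior v (algebraMap ℝ (Forms V) r) = 0 :=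
  CliffordAlgebra.contractLeft_algebraMap _ _ _

theorem interior_ι_mul (v : V) (f : Module.Dual ℝ V) (x : Forms V) :
    interior v (ExteriorAlgebra.ι ℝ f * x) = f v • x - ExteriorAlgebra.ι ℝ f * interior v x :=
  CliffordAlgebra.contractLeft_ι_mul _ _ _

theorem interior_comm (v w : V) (x : Forms V) :
    interior v (interior w x) = -interior w (interior v x) :=
  CliffordAlgebra.contractLeft_comm _ _ x

theorem apply_sharp_comm (f h : Module.Dual ℝ V) : f (sharp V h) = h (sharp V f) := by
  rw [← inner_sharp V f, ← inner_sharp V h, real_inner_comm]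

theorem sum_smul_interior {ι : Type*} [Fintype ι] (e : OrthonormalBasis ι ℝ V)
    (f : Module.Dual ℝ V) (x : Forms V) :
    ∑ i, f (e i) • interior (e i) x = interior (sharp V f) x := by
  have h : sharp V f = ∑ i, f (e i) • e i := by
    conv_lhs => rw [← e.sum_repr' (sharp V f)]
    refine Finset.sum_congr rfl fun i _ => ?_
    rw [real_inner_comm, inner_sharp]
  simp [h, interior, map_sum]

/-- Interior product of forms with forms: the adjoint of the exterior multiplication
`η ↦ θ ∧ η`. -/
def interiorForm : Forms V →ₗ[ℝ] Module.End ℝ (Forms V) :=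
  (interiorMulti V).toLinearMap ∘ₗ CliffordAlgebra.reverse (Q := (0 : QuadraticForm ℝ V)) ∘ₗ
    (ExteriorAlgebra.map (sharp V)).toLinearMap

@[simp]
theorem interiorForm_algebraMap (r : ℝ) (x : Forms V) :
    interiorForm (algebraMap ℝ (Forms V) r) x = r • x := by
  have : CliffordAlgebra.reverse (algebraMap ℝ (ExteriorAlgebra ℝ V) r) =
    algebraMap ℝ (ExteriorAlgebra ℝ V) r := CliffordAlgebra.reverse.commutes r
  simp [interiorForm, this, Module.algebraMap_end_apply]

@[simp]
theorem interiorForm_one (x : Forms V) : interiorForm (1 : Forms V) x = x := by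
  simpa using interiorForm_algebraMap 1 x

@[simp]
theorem interiorForm_ι (f : Module.Dual ℝ V) (x : Forms V) :
    interiorForm (ExteriorAlgebra.ι ℝ f) x = interior (sharp V f) x := by
  have : CliffordAlgebra.reverse (ExteriorAlgebra.ι ℝ (sharp V f)) =
    ExteriorAlgebra.ι ℝ (sharp V f) := CliffordAlgebra.reverse_ι _
  simp [interiorForm, this, interiorMulti, interior]

/-- The order is reversed because of `reverse` in the definition; this is what makes `interiorForm
θ` adjoint to multiplication by θ on the left, without signs. -/
theorem interiorForm_mul (θ η x : Forms V) :
    interiorForm (θ * η) x = interiorForm η (interiorForm θ x) := by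
  have : ∀ a b : ExteriorAlgebra ℝ V, CliffordAlgebra.reverse (a * b) =
    CliffordAlgebra.reverse b * CliffordAlgebra.reverse a := CliffordAlgebra.reverse.map_mul
  simp [interiorForm, this]

theorem formStar_apply {n : ℕ} (e : OrthonormalBasis (Fin n) ℝ V) (θ : Forms V) :
    formStar e θ = interiorForm θ (volumeForm e) := rfl

/-- Induction on forms, multiplying by one-forms from the left. -/
theorem forms_induction_left {P : Forms V → Prop}
    (algebraMap : ∀ r : ℝ, P (algebraMap ℝ (Forms V) r))
    (add : ∀ x y, P x → P y → P (x + y))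
    (ι_mul : ∀ (x : Forms V) (f : Module.Dual ℝ V), P x → P (ExteriorAlgebra.ι ℝ f * x))
    (x : Forms V) : P x :=
  CliffordAlgebra.left_induction (Q := (0 : QuadraticForm ℝ (Module.Dual ℝ V)))
    algebraMap add (fun x f h => ι_mul x f h) x

/-- Induction on forms, multiplying by one-forms from the right. -/
theorem forms_induction_right {P : Forms V → Prop}
    (algebraMap : ∀ r : ℝ, P (algebraMap ℝ (Forms V) r))
    (add : ∀ x y, P x → P y → P (x + y))
    (mul_ι : ∀ (x : Forms V) (f : Module.Dual ℝ V), P x → P (x * ExteriorAlgebra.ι ℝ f))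
    (x : Forms V) : P x :=
  CliffordAlgebra.right_induction (Q := (0 : QuadraticForm ℝ (Module.Dual ℝ V)))
    algebraMap add (fun f x h => mul_ι x f h) x

/-- Induction on homogeneous forms, multiplying by one-forms from the left. -/
theorem exteriorPower_induction {P : ℕ → Forms V → Prop}
    (algebraMap : ∀ r : ℝ, P 0 (algebraMap ℝ (Forms V) r))
    (add : ∀ k x y, P k x → P k y → P k (x + y))
    (ι_mul : ∀ k (x : Forms V) (f : Module.Dual ℝ V), x ∈ ⋀[ℝ]^k (Module.Dual ℝ V) → P k x →
      P (k + 1) (ExteriorAlgebra.ι ℝ f * x))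
    {k : ℕ} {x : Forms V} (hx : x ∈ ⋀[ℝ]^k (Module.Dual ℝ V)) : P k x := by
  refine Submodule.pow_induction_on_left' (C := fun k x _ => P k x) _ algebraMap
    (fun x y i _ _ => add i x y) ?_ hx
  rintro _ ⟨f, rfl⟩ i x hx h
  exact ι_mul i x f hx h

theorem ι_mul_mem {k : ℕ} {x : Forms V} (f : Module.Dual ℝ V)
    (hx : x ∈ ⋀[ℝ]^k (Module.Dual ℝ V)) :
    ExteriorAlgebra.ι ℝ f * x ∈ ⋀[ℝ]^(k + 1) (Module.Dual ℝ V) := by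
  rw [ExteriorAlgebra.exteriorPower, pow_succ']
  exact Submodule.mul_mem_mul (LinearMap.mem_range_self _ f) hx

theorem algebraMap_mem (r : ℝ) :
    algebraMap ℝ (Forms V) r ∈ ⋀[ℝ]^0 (Module.Dual ℝ V) := by
  rw [ExteriorAlgebra.exteriorPower, pow_zero]
  exact Submodule.algebraMap_mem r

/-- The truncated k - 1 is harmless at k = 0, where the interior product vanishes. -/
theorem interior_mem (v : V) {k : ℕ} {x : Forms V} (hx : x ∈ ⋀[ℝ]^k (Module.Dual ℝ V)) :
    interior v x ∈ ⋀[ℝ]^(k - 1) (Module.Dual ℝ V) := by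
  refine exteriorPower_induction
    (P := fun k x => interior v x ∈ ⋀[ℝ]^(k - 1) (Module.Dual ℝ V)) ?_ ?_ ?_ hx
  · intro r; simp
  · intro k x y hx hy; rw [map_add]; exact add_mem hx hy
  · intro k x f hx h
    rw [interior_ι_mul]
    refine sub_mem (Submodule.smul_mem _ _ hx) ?_
    rcases k with _ | k
    · rw [ExteriorAlgebra.exteriorPower, pow_zero, Submodule.mem_one] at hx
      obtain ⟨r, rfl⟩ := hx
      simp
    · exact ι_mul_mem f h

theorem interiorForm_mem {s r : ℕ} {x z : Forms V} (hx : x ∈ ⋀[ℝ]^s (Module.Dual ℝ V))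
    (hz : z ∈ ⋀[ℝ]^(s + r) (Module.Dual ℝ V)) :
    interiorForm x z ∈ ⋀[ℝ]^r (Module.Dual ℝ V) := by
  refine exteriorPower_induction (P := fun s x => ∀ z ∈ ⋀[ℝ]^(s + r) (Module.Dual ℝ V),
    interiorForm x z ∈ ⋀[ℝ]^r (Module.Dual ℝ V)) ?_ ?_ ?_ hx z hz
  · intro a z hz
    rw [interiorForm_algebraMap]
    rw [zero_add] at hz
    exact Submodule.smul_mem _ _ hz
  · intro k x y hx hy z hz
    rw [map_add]
    exact add_mem (hx z hz) (hy z hz)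
  · intro k x f _ h z hz
    rw [interiorForm_mul, interiorForm_ι]
    refine h _ ?_
    have := interior_mem (sharp V f) hz
    rwa [show k + 1 + r - 1 = k + r by omega] at this

/-- The grade involution of forms, `θ ↦ (-1)^k θ` for `k`-forms. -/
abbrev gradeInvolution : Forms V →ₐ[ℝ] Forms V :=
  CliffordAlgebra.involute (Q := (0 : QuadraticForm ℝ (Module.Dual ℝ V)))

theorem gradeInvolution_ι (f : Module.Dual ℝ V) :
    gradeInvolution (ExteriorAlgebra.ι ℝ f) = -ExteriorAlgebra.ι ℝ f :=
  CliffordAlgebra.involute_ι f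

theorem gradeInvolution_of_mem {k : ℕ} {x : Forms V} (hx : x ∈ ⋀[ℝ]^k (Module.Dual ℝ V)) :
    gradeInvolution x = (-1 : ℝ) ^ k • x := by
  refine exteriorPower_induction (P := fun k x => gradeInvolution x = (-1 : ℝ) ^ k • x)
    ?_ ?_ ?_ hx
  · intro r
    rw [AlgHom.commutes]; simp
  · intro k x y hx hy; rw [map_add, hx, hy, smul_add]
  · intro k x f _ h
    rw [map_mul, h, gradeInvolution_ι, pow_succ]
    simp

theorem interior_gradeInvolution (v : V) (x : Forms V) :
    interior v (gradeInvolution x) = -gradeInvolution (interior v x) := by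
  induction x using forms_induction_left with
  | algebraMap r => rw [AlgHom.commutes]; simp
  | add x y hx hy => simp only [map_add, hx, hy, neg_add]
  | ι_mul x f h =>
    rw [map_mul, gradeInvolution_ι, neg_mul, map_neg, interior_ι_mul, h, interior_ι_mul, map_sub,
      map_mul, gradeInvolution_ι, map_smul]
    simp

/-- Interior products with vectors anticommute, so each one-form factor of x contributes one sign.
-/
theorem interior_interiorForm (v : V) (x z : Forms V) :
    interior v (interiorForm x z) = interiorForm (gradeInvolution x) (interior v z) := by
  induction x using forms_induction_left generalizing z with
  | algebraMap r => rw [AlgHom.commutes]; simp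
  | add x y hx hy => simp only [map_add, LinearMap.add_apply, hx, hy]
  | ι_mul x f h =>
    rw [interiorForm_mul, h, map_mul, gradeInvolution_ι, interiorForm_mul, map_neg,
      LinearMap.neg_apply, interiorForm_ι, interiorForm_ι, interior_comm]

theorem interiorForm_gradeInvolution (x z : Forms V) :
    interiorForm (gradeInvolution x) (gradeInvolution z) = gradeInvolution (interiorForm x z) := by
  induction x using forms_induction_left generalizing z with
  | algebraMap r => rw [AlgHom.commutes]; simp
  | add x y hx hy => simp only [map_add, LinearMap.add_apply, hx, hy]
  | ι_mul x f h =>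
    rw [interiorForm_mul, ← h, map_mul, gradeInvolution_ι, interiorForm_mul, map_neg,
      LinearMap.neg_apply, interiorForm_ι, interiorForm_ι, interior_gradeInvolution, neg_neg]

/-- Graded Leibniz rule: either one factor of β is paired with f, or all of β passes over f. It
drives both the reordering formula and the Hodge star computations. -/
theorem interiorForm_ι_mul (β : Forms V) (f : Module.Dual ℝ V) (x : Forms V) :
    interiorForm β (ExteriorAlgebra.ι ℝ f * x) = interiorForm (interior (sharp V f) β) x +
      ExteriorAlgebra.ι ℝ f * interiorForm (gradeInvolution β) x := by
  induction β using forms_induction_left generalizing x with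
  | algebraMap r => rw [AlgHom.commutes]; simp
  | add y z hy hz => simp only [map_add, LinearMap.add_apply, hy, hz, mul_add]; abel
  | ι_mul y h ih =>
    rw [interiorForm_mul, interiorForm_ι, interior_ι_mul, map_sub, map_smul, ih, interior_ι_mul,
      map_sub, LinearMap.sub_apply, map_smul, LinearMap.smul_apply, interiorForm_mul,
      interiorForm_ι, map_mul, gradeInvolution_ι, interiorForm_mul, map_neg,
      LinearMap.neg_apply, interiorForm_ι, apply_sharp_comm]
    simp only [map_neg, mul_neg]
    abel

/-! ### The inner product of forms -/

theorem component_ιMulti_self {M : Type*} [AddCommGroup M] [Module ℝ M] (k : ℕ) (v : Fin k → M) :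
    component k (ExteriorAlgebra.ιMulti ℝ k v) = exteriorPower.ιMulti ℝ k v := by
  have := DirectSum.decompose_coe (fun i : ℕ => ⋀[ℝ]^i M) (exteriorPower.ιMulti ℝ k v)
  rw [exteriorPower.ιMulti_apply_coe] at this
  change DirectSum.component ℝ ℕ _ k (DirectSum.decompose (fun i : ℕ => ⋀[ℝ]^i M) _) = _
  rw [this]
  exact DirectSum.component.lof_self ℝ _ _

theorem component_ιMulti_of_ne {M : Type*} [AddCommGroup M] [Module ℝ M] {k l : ℕ} (h : k ≠ l)
    (v : Fin k → M) : component l (ExteriorAlgebra.ιMulti ℝ k v) = 0 := by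
  have := DirectSum.decompose_coe (fun i : ℕ => ⋀[ℝ]^i M) (exteriorPower.ιMulti ℝ k v)
  rw [exteriorPower.ιMulti_apply_coe] at this
  change DirectSum.component ℝ ℕ _ l (DirectSum.decompose (fun i : ℕ => ⋀[ℝ]^i M) _) = _
  rw [this]
  exact DFinsupp.single_eq_of_ne h.symm

theorem ιMulti_eq_zero {k : ℕ} (hk : Module.finrank ℝ V < k) (v : Fin k → V) :
    ExteriorAlgebra.ιMulti ℝ k v = 0 := by
  refine AlternatingMap.map_linearDependent _ _ fun h => ?_
  have := h.fintype_card_le_finrank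
  simp at this
  omega

theorem formInner_ιMulti_self {k : ℕ} (f h : Fin k → Module.Dual ℝ V) :
    formInner V (ExteriorAlgebra.ιMulti ℝ k f) (ExteriorAlgebra.ιMulti ℝ k h) =
      Matrix.det (Matrix.of fun i j => h i (sharp V (f j))) := by
  have key : ∀ x y : Fin k → V, Matrix.det (Matrix.of fun i j => inner ℝ (x j) (y i)) =
      inner ℝ (exteriorPower.ιMulti ℝ k x) (exteriorPower.ιMulti ℝ k y) :=
    fun x y => (exteriorPower.inner_ιMulti_ιMulti x y).symm
  have h2 : Matrix.det (Matrix.of fun i j => h i (sharp V (f j))) =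
      inner ℝ (exteriorPower.ιMulti ℝ k (sharp V ∘ f)) (exteriorPower.ιMulti ℝ k (sharp V ∘ h)) := by
    rw [← key]
    congr 2
    ext i j
    rw [Function.comp_apply, Function.comp_apply, real_inner_comm, inner_sharp]
  rw [h2, formInner, LinearMap.sum_apply, LinearMap.sum_apply]
  simp only [LinearMap.compl₁₂_apply, LinearMap.comp_apply, AlgHom.toLinearMap_apply,
    ExteriorAlgebra.map_apply_ιMulti, innerₗ_apply_apply]
  rw [Finset.sum_eq_single k]
  · rw [component_ιMulti_self, component_ιMulti_self]
  · intro l _ hl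
    rw [component_ιMulti_of_ne hl.symm, inner_zero_left]
  -- The sum defining `formInner` stops at dim V; for larger k the missing summand is zero anyway.
  · intro hk
    rw [ιMulti_eq_zero (by simpa using hk), map_zero, inner_zero_left]

theorem formInner_ιMulti_of_ne {k l : ℕ} (hkl : k ≠ l) (f : Fin k → Module.Dual ℝ V)
    (h : Fin l → Module.Dual ℝ V) :
    formInner V (ExteriorAlgebra.ιMulti ℝ k f) (ExteriorAlgebra.ιMulti ℝ l h) = 0 := by
  rw [formInner, LinearMap.sum_apply, LinearMap.sum_apply]
  simp only [LinearMap.compl₁₂_apply, LinearMap.comp_apply, AlgHom.toLinearMap_apply,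
    ExteriorAlgebra.map_apply_ιMulti, innerₗ_apply_apply]
  refine Finset.sum_eq_zero fun m _ => ?_
  by_cases hk : k = m
  · rw [component_ιMulti_of_ne (l := m) (k := l) (by omega), inner_zero_right]
  · rw [component_ιMulti_of_ne hk, inner_zero_left]

theorem formInner_comm (θ η : Forms V) : formInner V θ η = formInner V η θ := by
  rw [formInner, LinearMap.sum_apply, LinearMap.sum_apply, LinearMap.sum_apply, LinearMap.sum_apply]
  simp only [LinearMap.compl₁₂_apply, innerₗ_apply_apply, real_inner_comm]

theorem interior_ιMulti (v : V) {k : ℕ} (h : Fin (k + 1) → Module.Dual ℝ V) :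
    interior v (ExteriorAlgebra.ιMulti ℝ (k + 1) h) =
      ∑ i : Fin (k + 1), ((-1 : ℝ) ^ (i : ℕ) * h i v) •
        ExteriorAlgebra.ιMulti ℝ k (h ∘ i.succAbove) := by
  induction k with
  | zero =>
    have := interior_ι_mul v (h 0) 1
    rw [mul_one, interior_one, mul_zero, sub_zero] at this
    simp [this]
  | succ k ih =>
    rw [ExteriorAlgebra.ιMulti_succ_apply, interior_ι_mul, ih, Fin.sum_univ_succ (n := k + 1), Finset.mul_sum,
      sub_eq_add_neg, ← Finset.sum_neg_distrib]
    congr 1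
    · simp [Matrix.vecTail]
    · refine Finset.sum_congr rfl fun i _ => ?_
      rw [ExteriorAlgebra.ιMulti_succ_apply]
      have hs : (h ∘ Fin.succ) ∘ i.succAbove = (h ∘ i.succ.succAbove) ∘ Fin.succ := by
        ext j
        simp
      simp [Matrix.vecTail, pow_succ, hs]

/-- On decomposable forms this is the Laplace expansion, along the column of f, of the Gram
determinant. -/
theorem formInner_ι_mul (f : Module.Dual ℝ V) (θ η : Forms V) :
    formInner V (ExteriorAlgebra.ι ℝ f * θ) η = formInner V θ (interior (sharp V f) η) := by
  suffices h : LinearMap.comp (formInner V) (LinearMap.mulLeft ℝ (ExteriorAlgebra.ι ℝ f)) =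
      LinearMap.compl₂ (formInner V) (interior (sharp V f)) from
    LinearMap.congr_fun₂ h θ η
  refine LinearMap.ext_on (ExteriorAlgebra.ιMulti_span ℝ (Module.Dual ℝ V)) ?_
  rintro _ ⟨⟨k, a⟩, rfl⟩
  refine LinearMap.ext_on (ExteriorAlgebra.ιMulti_span ℝ (Module.Dual ℝ V)) ?_
  rintro _ ⟨⟨l, b⟩, rfl⟩
  have hcons : ExteriorAlgebra.ι ℝ f * ExteriorAlgebra.ιMulti ℝ k a =
      ExteriorAlgebra.ιMulti ℝ (k + 1) (Fin.cons f a : Fin (k + 1) → Module.Dual ℝ V) := by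
    rw [ExteriorAlgebra.ιMulti_succ_apply]; rfl
  simp only [LinearMap.comp_apply, LinearMap.mulLeft_apply, LinearMap.compl₂_apply, hcons]
  rcases l with _ | l
  · rw [formInner_ιMulti_of_ne (by omega), ExteriorAlgebra.ιMulti_zero_apply, interior_one,
      map_zero]
  · rw [interior_ιMulti, map_sum]
    simp only [map_smul, smul_eq_mul]
    by_cases hkl : k = l
    · subst hkl
      rw [formInner_ιMulti_self, Matrix.det_succ_column_zero]
      refine Finset.sum_congr rfl fun i _ => ?_
      rw [formInner_ιMulti_self]
      rfl
    · rw [formInner_ιMulti_of_ne (by omega)]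
      refine (Finset.sum_eq_zero fun i _ => ?_).symm
      rw [formInner_ιMulti_of_ne hkl, mul_zero]

theorem formInner_one (η : Forms V) :
    formInner V 1 η = ExteriorAlgebra.algebraMapInv η := by
  suffices h : formInner V 1 = (ExteriorAlgebra.algebraMapInv (R := ℝ)
      (M := Module.Dual ℝ V)).toLinearMap from congrArg (fun B => B η) h
  refine LinearMap.ext_on (ExteriorAlgebra.ιMulti_span ℝ (Module.Dual ℝ V)) ?_
  rintro _ ⟨⟨l, b⟩, rfl⟩
  rw [← ExteriorAlgebra.ιMulti_zero_apply (R := ℝ) (0 : Fin 0 → Module.Dual ℝ V)]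
  rcases l with _ | l
  · rw [formInner_ιMulti_self]; simp
  · rw [formInner_ιMulti_of_ne (Nat.succ_ne_zero l).symm]
    simp [ExteriorAlgebra.algebraMapInv]

theorem formInner_mul (θ η ζ : Forms V) :
    formInner V (θ * η) ζ = formInner V η (interiorForm θ ζ) := by
  induction θ using forms_induction_left generalizing ζ with
  | algebraMap r => rw [interiorForm_algebraMap, ← Algebra.smul_def]; simp
  | add x y hx hy => simp only [add_mul, map_add, LinearMap.add_apply, hx, hy]
  | ι_mul x f h => rw [mul_assoc, formInner_ι_mul, h, interiorForm_mul, interiorForm_ι]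

/-! ### The inner product and the contraction of double forms -/

theorem innerProduct_tmul (θ₁ θ₂ θ₃ θ₄ : Forms V) :
    innerProduct V (θ₁ ⊗ₜ θ₂) (θ₃ ⊗ₜ θ₄) = formInner V θ₁ θ₃ * formInner V θ₂ θ₄ := by
  simp [innerProduct, mul_comm]

/-- The full contraction `θ ⊗ η ↦ ⟨θ, η⟩` of double forms. -/
def pairing : DoubleForm V →ₗ[ℝ] ℝ := TensorProduct.lift (formInner V)

theorem pairing_tmul (θ η : Forms V) : pairing (θ ⊗ₜ[ℝ] η) = formInner V θ η :=
  TensorProduct.lift.tmul _ _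

theorem contraction_tmul {ι : Type*} [Fintype ι] (e : OrthonormalBasis ι ℝ V) (θ η : Forms V) :
    contraction V (θ ⊗ₜ η) = ∑ i, interior (e i) θ ⊗ₜ interior (e i) η := by
  rw [contraction_eq_sum e, LinearMap.sum_apply]
  rfl

/-- Termwise in an orthonormal basis: exterior multiplication by e_i* is adjoint to ι_{e_i} in both
tensor factors. -/
theorem innerProduct_metric_mul (X Y : DoubleForm V) :
    innerProduct V (metric V * X) Y = innerProduct V X (contraction V Y) := by
  induction X using TensorProduct.induction_on with
  | zero => simp
  | add X X' h h' => simp only [mul_add, map_add, LinearMap.add_apply, h, h']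
  | tmul θ η =>
    induction Y using TensorProduct.induction_on with
    | zero => simp
    | add X X' h h' => simp only [map_add, h, h']
    | tmul θ' η' =>
      rw [contraction_tmul (stdOrthonormalBasis ℝ V), metric_eq_sum (stdOrthonormalBasis ℝ V),
        Finset.sum_mul, map_sum, map_sum, LinearMap.sum_apply]
      refine Finset.sum_congr rfl fun i _ => ?_
      have h : sharp V (innerₗ V (stdOrthonormalBasis ℝ V i)) = stdOrthonormalBasis ℝ V i :=
        ext_inner_right ℝ fun v => by rw [inner_sharp, innerₗ_apply_apply]
      rw [Algebra.TensorProduct.tmul_mul_tmul, innerProduct_tmul, innerProduct_tmul,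
        formInner_ι_mul, formInner_ι_mul, h]

theorem innerProduct_metric_pow_mul (k : ℕ) (X Y : DoubleForm V) :
    innerProduct V (metric V ^ k * X) Y = innerProduct V X ((contraction V ^ k) Y) := by
  induction k generalizing Y with
  | zero => simp
  | succ k ih =>
    rw [pow_succ', mul_assoc, innerProduct_metric_mul, ih, pow_succ, Module.End.mul_apply]

theorem contraction_lTensor_interior (v : V) (X : DoubleForm V) :
    contraction V ((interior v).lTensor (Forms V) X) =
      -(interior v).lTensor (Forms V) (contraction V X) := by
  induction X using TensorProduct.induction_on with
  | zero => simp
  | add X X' h h' => simp only [map_add, h, h', neg_add]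
  | tmul θ η =>
    rw [LinearMap.lTensor_tmul, contraction_tmul (stdOrthonormalBasis ℝ V),
      contraction_tmul (stdOrthonormalBasis ℝ V), map_sum, ← Finset.sum_neg_distrib]
    refine Finset.sum_congr rfl fun i _ => ?_
    rw [LinearMap.lTensor_tmul, ← TensorProduct.tmul_neg, interior_comm]

theorem contraction_ι_tmul_one_mul (f : Module.Dual ℝ V) (X : DoubleForm V) :
    contraction V (ExteriorAlgebra.ι ℝ f ⊗ₜ 1 * X) =
      (interior (sharp V f)).lTensor (Forms V) X -
        ExteriorAlgebra.ι ℝ f ⊗ₜ 1 * contraction V X := by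
  induction X using TensorProduct.induction_on with
  | zero => simp
  | add X X' h h' => simp only [mul_add, map_add, h, h']; abel
  | tmul θ η =>
    rw [LinearMap.lTensor_tmul, contraction_tmul (stdOrthonormalBasis ℝ V),
      Algebra.TensorProduct.tmul_mul_tmul, contraction_tmul (stdOrthonormalBasis ℝ V),
      ← sum_smul_interior (stdOrthonormalBasis ℝ V), TensorProduct.tmul_sum, Finset.mul_sum,
      ← Finset.sum_sub_distrib]
    refine Finset.sum_congr rfl fun i _ => ?_
    rw [interior_ι_mul, Algebra.TensorProduct.tmul_mul_tmul, TensorProduct.sub_tmul, one_mul,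
      one_mul, TensorProduct.smul_tmul]

/-- Iterates the rule for a single c. Moving c past f ⊗ 1 and past 1 ⊗ ι_{f♯} costs a sign each; the
two signs cancel, so the m + 1 correction terms add up. -/
theorem contraction_pow_succ_ι_tmul_one_mul (m : ℕ) (f : Module.Dual ℝ V) (X : DoubleForm V) :
    (contraction V ^ (m + 1)) (ExteriorAlgebra.ι ℝ f ⊗ₜ 1 * X) =
      (-1 : ℝ) ^ (m + 1) • (ExteriorAlgebra.ι ℝ f ⊗ₜ 1 * (contraction V ^ (m + 1)) X) +
        ((m : ℝ) + 1) • (contraction V ^ m) ((interior (sharp V f)).lTensor (Forms V) X) := by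
  induction m generalizing X with
  | zero => simp [contraction_ι_tmul_one_mul]; abel
  | succ m ih =>
    have hc : ∀ Y : DoubleForm V, (contraction V ^ (m + 1)) (contraction V Y) =
        (contraction V ^ (m + 1 + 1)) Y := fun Y => by rw [pow_succ _ (m + 1)]; rfl
    have hd : ∀ Y : DoubleForm V, (contraction V ^ m) (contraction V Y) =
        (contraction V ^ (m + 1)) Y := fun Y => by rw [pow_succ]; rfl
    rw [← hc, contraction_ι_tmul_one_mul, map_sub, ih, hc, ← neg_eq_iff_eq_neg.mpr
      (contraction_lTensor_interior _ _), map_neg, hd, pow_succ (-1 : ℝ) (m + 1)]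
    push_cast
    module

/-- Truncated bidegrees do not record this vanishing, hence a separate induction on the degree of α.
-/
theorem contraction_pow_eq_zero {a r : ℕ} {α : Forms V} (hα : α ∈ ⋀[ℝ]^a (Module.Dual ℝ V))
    (hr : a < r) (β : Forms V) : (contraction V ^ r) (α ⊗ₜ β) = 0 := by
  refine exteriorPower_induction (P := fun a α => ∀ r, a < r → ∀ β : Forms V,
    (contraction V ^ r) (α ⊗ₜ β) = 0) ?_ ?_ ?_ hα r hr β
  · intro s r hr β
    obtain ⟨r, rfl⟩ := Nat.exists_eq_succ_of_ne_zero (Nat.ne_zero_of_lt hr)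
    rw [Nat.succ_eq_add_one, pow_succ, Module.End.mul_apply,
      contraction_tmul (stdOrthonormalBasis ℝ V)]
    simp
  · intro k x y hx hy r hr β
    rw [TensorProduct.add_tmul, map_add, hx r hr, hy r hr, add_zero]
  · intro k x f _ h r hr β
    obtain ⟨r, rfl⟩ := Nat.exists_eq_succ_of_ne_zero (Nat.ne_zero_of_lt hr)
    have : (ExteriorAlgebra.ι ℝ f * x) ⊗ₜ[ℝ] β = ExteriorAlgebra.ι ℝ f ⊗ₜ 1 * x ⊗ₜ β := by
      rw [Algebra.TensorProduct.tmul_mul_tmul, one_mul]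
    rw [this, Nat.succ_eq_add_one, contraction_pow_succ_ι_tmul_one_mul, LinearMap.lTensor_tmul,
      h _ (by omega), h _ (by omega)]
    simp

/-- Peel one-forms off θ: a term beginning with f ⊗ 1 is orthogonal to 1, and the remaining term
supplies the factor m + 1 of the factorial. -/
theorem innerProduct_one_contraction_pow_tmul {m : ℕ} {θ : Forms V}
    (hθ : θ ∈ ⋀[ℝ]^m (Module.Dual ℝ V)) (η : Forms V) :
    innerProduct V 1 ((contraction V ^ m) (θ ⊗ₜ η)) = (m.factorial : ℝ) * formInner V θ η := by
  refine exteriorPower_induction (P := fun m θ => ∀ η : Forms V,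
    innerProduct V 1 ((contraction V ^ m) (θ ⊗ₜ η)) = (m.factorial : ℝ) * formInner V θ η)
    ?_ ?_ ?_ hθ η
  · intro r η
    rw [Algebra.algebraMap_eq_smul_one r, Algebra.TensorProduct.one_def, pow_zero,
      Module.End.one_apply, innerProduct_tmul, map_smul, map_smul, LinearMap.smul_apply, formInner_one 1, map_one]
    simp
  · intro k x y hx hy η
    rw [TensorProduct.add_tmul, map_add, map_add, hx, hy, map_add, LinearMap.add_apply, mul_add]
  · intro k x f _ h η
    have h1 : (ExteriorAlgebra.ι ℝ f * x) ⊗ₜ[ℝ] η = ExteriorAlgebra.ι ℝ f ⊗ₜ 1 * x ⊗ₜ η := by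
      rw [Algebra.TensorProduct.tmul_mul_tmul, one_mul]
    have h2 : ∀ X : DoubleForm V, innerProduct V 1 (ExteriorAlgebra.ι ℝ f ⊗ₜ 1 * X) = 0 := by
      intro X
      induction X using TensorProduct.induction_on with
      | zero => simp
      | add X X' h h' => rw [mul_add, map_add, h, h', add_zero]
      | tmul θ η =>
        rw [Algebra.TensorProduct.tmul_mul_tmul, Algebra.TensorProduct.one_def, innerProduct_tmul,
          formInner_comm, formInner_ι_mul, interior_one, map_zero, zero_mul]
    rw [h1, contraction_pow_succ_ι_tmul_one_mul, map_add, map_smul, h2, map_smul,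
      LinearMap.lTensor_tmul, h, formInner_ι_mul, Nat.factorial_succ]
    push_cast
    simp [mul_assoc]

/-! ### Bihomogeneous double forms -/

theorem tmul_mem_bidegree {p q : ℕ} {θ η : Forms V} (hθ : θ ∈ ⋀[ℝ]^p (Module.Dual ℝ V))
    (hη : η ∈ ⋀[ℝ]^q (Module.Dual ℝ V)) : θ ⊗ₜ η ∈ bidegree V p q :=
  ⟨⟨θ, hθ⟩ ⊗ₜ ⟨η, hη⟩, rfl⟩

/-- Induction on bihomogeneous double forms. -/
theorem bidegree_induction {p q : ℕ} {P : DoubleForm V → Prop} (zero : P 0)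
    (add : ∀ X Y, P X → P Y → P (X + Y))
    (tmul : ∀ θ ∈ ⋀[ℝ]^p (Module.Dual ℝ V), ∀ η ∈ ⋀[ℝ]^q (Module.Dual ℝ V), P (θ ⊗ₜ η))
    {X : DoubleForm V} (hX : X ∈ bidegree V p q) : P X := by
  obtain ⟨Y, rfl⟩ := hX
  induction Y using TensorProduct.induction_on with
  | zero => rwa [map_zero]
  | add Y Y' h h' => rw [map_add]; exact add _ _ h h'
  | tmul θ η => exact tmul _ θ.2 _ η.2

theorem mul_mem_bidegree {p q p' q' : ℕ} {X Y : DoubleForm V} (hX : X ∈ bidegree V p q)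
    (hY : Y ∈ bidegree V p' q') : X * Y ∈ bidegree V (p + p') (q + q') := by
  refine bidegree_induction (P := fun X => X * Y ∈ bidegree V (p + p') (q + q')) ?_ ?_ ?_ hX
  · simp
  · intro X X' h h'; rw [add_mul]; exact add_mem h h'
  intro θ hθ η hη
  refine bidegree_induction (P := fun Y => θ ⊗ₜ η * Y ∈ bidegree V (p + p') (q + q')) ?_ ?_ ?_ hY
  · simp
  · intro X X' h h'; rw [mul_add]; exact add_mem h h'
  intro θ' hθ' η' hη'
  rw [Algebra.TensorProduct.tmul_mul_tmul]
  refine tmul_mem_bidegree ?_ ?_ <;>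
  · rw [ExteriorAlgebra.exteriorPower, pow_add]
    exact Submodule.mul_mem_mul ‹_› ‹_›

theorem one_mem_bidegree : (1 : DoubleForm V) ∈ bidegree V 0 0 := by
  have h := algebraMap_mem (V := V) 1
  rw [map_one] at h
  exact tmul_mem_bidegree h h

theorem pow_mem_bidegree {p : ℕ} {X : DoubleForm V} (hX : X ∈ bidegree V p p) (q : ℕ) :
    X ^ q ∈ bidegree V (p * q) (p * q) := by
  induction q with
  | zero => simpa using one_mem_bidegree
  | succ q ih => rw [pow_succ, mul_add_one]; exact mul_mem_bidegree ih hX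

theorem contraction_mem_bidegree {p q : ℕ} {X : DoubleForm V} (hX : X ∈ bidegree V p q) :
    contraction V X ∈ bidegree V (p - 1) (q - 1) := by
  refine bidegree_induction (P := fun X => contraction V X ∈ bidegree V (p - 1) (q - 1))
    ?_ ?_ ?_ hX
  · simp
  · intro X X' h h'; rw [map_add]; exact add_mem h h'
  · intro θ hθ η hη
    rw [contraction_tmul (stdOrthonormalBasis ℝ V)]
    exact sum_mem fun i _ => tmul_mem_bidegree (interior_mem _ hθ) (interior_mem _ hη)

theorem contraction_pow_mem_bidegree {p q : ℕ} {X : DoubleForm V} (hX : X ∈ bidegree V p q)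
    (r : ℕ) : (contraction V ^ r) X ∈ bidegree V (p - r) (q - r) := by
  induction r with
  | zero => simpa using hX
  | succ r ih =>
    rw [pow_succ', Module.End.mul_apply]
    exact contraction_mem_bidegree ih

theorem eq_algebraMap_of_mem_bidegree {X : DoubleForm V} (hX : X ∈ bidegree V 0 0) :
    X = algebraMap ℝ (DoubleForm V) (innerProduct V 1 X) := by
  refine bidegree_induction (P := fun X => X = algebraMap ℝ (DoubleForm V) (innerProduct V 1 X))
    ?_ ?_ ?_ hX
  · simp
  · intro X Y h h'; rw [map_add, map_add, ← h, ← h']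
  · intro θ hθ η hη
    rw [ExteriorAlgebra.exteriorPower, pow_zero, Submodule.mem_one] at hθ hη
    obtain ⟨a, rfl⟩ := hθ
    obtain ⟨b, rfl⟩ := hη
    rw [Algebra.TensorProduct.one_def, innerProduct_tmul, formInner_one, formInner_one,
      ExteriorAlgebra.algebraMap_leftInverse, ExteriorAlgebra.algebraMap_leftInverse,
      Algebra.algebraMap_eq_smul_one, Algebra.algebraMap_eq_smul_one,
      Algebra.algebraMap_eq_smul_one, TensorProduct.smul_tmul_smul,
      Algebra.TensorProduct.one_def]

theorem innerProduct_one_contraction_pow {m : ℕ} {X : DoubleForm V} (hX : X ∈ bidegree V m m) :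
    innerProduct V 1 ((contraction V ^ m) X) = (m.factorial : ℝ) * pairing X := by
  refine bidegree_induction (P := fun X => innerProduct V 1 ((contraction V ^ m) X) =
    (m.factorial : ℝ) * pairing X) ?_ ?_ ?_ hX
  · simp
  · intro X Y h h'; simp only [map_add, h, h', mul_add]
  · intro θ hθ η _
    rw [innerProduct_one_contraction_pow_tmul hθ, pairing_tmul]

theorem contraction_pow_eq_algebraMap {m : ℕ} {X : DoubleForm V} (hX : X ∈ bidegree V m m) :
    (contraction V ^ m) X = algebraMap ℝ (DoubleForm V) ((m.factorial : ℝ) * pairing X) := by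
  have h := contraction_pow_mem_bidegree hX m
  rw [Nat.sub_self] at h
  rw [← innerProduct_one_contraction_pow hX]
  exact eq_algebraMap_of_mem_bidegree h

/-! ### The commutation relation of exterior and interior products -/

/-- The map `θ ⊗ η ↦ θ ∧ ι_η ζ`. -/
def mulInterior (ζ : Forms V) : DoubleForm V →ₗ[ℝ] Forms V :=
  TensorProduct.lift ((LinearMap.mul ℝ (Forms V)).compl₂ (interiorForm.flip ζ))

theorem mulInterior_tmul (ζ θ η : Forms V) :
    mulInterior ζ (θ ⊗ₜ η) = θ * interiorForm η ζ :=
  TensorProduct.lift.tmul _ _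

theorem mulInterior_ι_tmul_one_mul (ζ : Forms V) (f : Module.Dual ℝ V) (X : DoubleForm V) :
    mulInterior ζ (ExteriorAlgebra.ι ℝ f ⊗ₜ 1 * X) = ExteriorAlgebra.ι ℝ f * mulInterior ζ X := by
  induction X using TensorProduct.induction_on with
  | zero => simp
  | add X X' h h' => simp only [mul_add, map_add, h, h']
  | tmul θ η =>
    rw [Algebra.TensorProduct.tmul_mul_tmul, mulInterior_tmul, mulInterior_tmul, one_mul, mul_assoc]

/-- Reordering of an interior product with `β` after an exterior product with `α`, in terms of the
contractions of `α ⊗ β`. -/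
theorem interiorForm_mul_eq_sum {a b R : ℕ} {α β : Forms V}
    (hα : α ∈ ⋀[ℝ]^a (Module.Dual ℝ V)) (hβ : gradeInvolution β = (-1 : ℝ) ^ b • β) (hR : a < R)
    (ζ : Forms V) :
    interiorForm β (α * ζ) = ∑ r ∈ Finset.range R,
      ((-1 : ℝ) ^ ((a + r) * (b + r)) / (r.factorial : ℝ)) •
        mulInterior ζ ((contraction V ^ r) (α ⊗ₜ β)) := by
  -- Only the parity of β enters, so ι_f β can be given b + 1 and no subtraction is needed. Any R >
  -- a will do, since c^r(α ⊗ β) = 0 for r > a; the induction uses both R and R + 1.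
  refine exteriorPower_induction (P := fun a α => ∀ (R b : ℕ) (β : Forms V),
    gradeInvolution β = (-1 : ℝ) ^ b • β → a < R →
    interiorForm β (α * ζ) = ∑ r ∈ Finset.range R,
      ((-1 : ℝ) ^ ((a + r) * (b + r)) / (r.factorial : ℝ)) •
        mulInterior ζ ((contraction V ^ r) (α ⊗ₜ β))) ?_ ?_ ?_ hα R b β hβ hR
  · intro s R b β _ hR
    rw [Finset.sum_eq_single 0]
    · simp only [mulInterior_tmul, pow_zero, Module.End.one_apply, ← Algebra.smul_def, map_smul]
      simp
    · intro r _ hr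
      rw [contraction_pow_eq_zero (algebraMap_mem s) (Nat.pos_of_ne_zero hr), map_zero, smul_zero]
    · intro h
      exact absurd (Finset.mem_range.mpr hR) h
  · intro k x y hx hy R b β hβ hR
    simp only [add_mul x y, map_add, TensorProduct.add_tmul, smul_add, Finset.sum_add_distrib]
    rw [hx R b β hβ hR, hy R b β hβ hR]
  · intro a x f hx h R b β hβ hR
    obtain ⟨R, rfl⟩ := Nat.exists_eq_succ_of_ne_zero (Nat.ne_zero_of_lt hR)
    have h1 : (ExteriorAlgebra.ι ℝ f * x) ⊗ₜ[ℝ] β = ExteriorAlgebra.ι ℝ f ⊗ₜ 1 * x ⊗ₜ β := by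
      rw [Algebra.TensorProduct.tmul_mul_tmul, one_mul]
    have h2 : gradeInvolution (interior (sharp V f) β) =
        (-1 : ℝ) ^ (b + 1) • interior (sharp V f) β := by
      rw [← neg_eq_iff_eq_neg.mpr (interior_gradeInvolution (sharp V f) β), hβ, map_smul, pow_succ]
      simp
    have sign₁ : ∀ r, (-1 : ℝ) ^ ((a + 1 + r) * (b + r)) * (-1) ^ r =
        (-1) ^ b * (-1) ^ ((a + r) * (b + r)) := by
      intro r
      rw [← pow_add, ← pow_add, show (a + 1 + r) * (b + r) + r = b + (a + r) * (b + r) + 2 * r by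
        ring, pow_add _ _ (2 * r), pow_mul]
      simp
    have sign₂ : ∀ r, (-1 : ℝ) ^ ((a + 1 + (r + 1)) * (b + (r + 1))) =
        (-1) ^ ((a + r) * (b + 1 + r)) := by
      intro r
      rw [show (a + 1 + (r + 1)) * (b + (r + 1)) = (a + r) * (b + 1 + r) + 2 * (b + 1 + r) by
        ring, pow_add _ _ (2 * (b + 1 + r)), pow_mul _ 2]
      simp
    -- The Leibniz rule splits the left side into a term with ι_f β and a term beginning with f. The
    -- terms r ≥ 1 on the right split in the same way, with r shifted by one in the ι_f β part;
    -- `sign₁` and `sign₂` match the coefficients.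
    rw [mul_assoc, interiorForm_ι_mul, h R (b + 1) _ h2 (by omega), hβ, map_smul,
      LinearMap.smul_apply, h (R + 1) b β hβ (by omega), h1, Finset.sum_range_succ',
      Finset.sum_range_succ' (n := R)]
    simp only [contraction_pow_succ_ι_tmul_one_mul, map_add, map_smul, mulInterior_ι_tmul_one_mul,
      LinearMap.lTensor_tmul, smul_add, Finset.sum_add_distrib,
      mul_add (ExteriorAlgebra.ι ℝ f), mul_smul_comm,
      Finset.mul_sum, Finset.smul_sum, smul_smul]
    rw [add_comm, add_right_comm, pow_zero, Module.End.one_apply, Module.End.one_apply,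
      mulInterior_ι_tmul_one_mul]
    congr 1
    · congr 1
      · refine Finset.sum_congr rfl fun r _ => ?_
        congr 1
        rw [mul_div_assoc', ← sign₁]
        ring
      · refine Finset.sum_congr rfl fun r _ => ?_
        congr 1
        rw [sign₂, Nat.factorial_succ]
        push_cast
        field_simp
    · congr 1
      have := sign₁ 0
      rw [pow_zero, mul_one] at this
      rw [mul_div_assoc', ← this]

/-- Contractions as sums over interior products with `k`-forms. -/
theorem formInner_interiorForm_interiorForm {s r : ℕ} {x y α β : Forms V}
    (hx : x ∈ ⋀[ℝ]^s (Module.Dual ℝ V)) (hy : y ∈ ⋀[ℝ]^s (Module.Dual ℝ V))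
    (hα : α ∈ ⋀[ℝ]^(s + r) (Module.Dual ℝ V)) :
    (r.factorial : ℝ) * formInner V (interiorForm x α) (interiorForm y β) =
      innerProduct V (x ⊗ₜ y) ((contraction V ^ r) (α ⊗ₜ β)) := by
  let T : DoubleForm V →ₗ[ℝ] DoubleForm V := TensorProduct.map (interiorForm x) (interiorForm y)
  have hT : ∀ X, innerProduct V 1 (T X) = innerProduct V (x ⊗ₜ y) X := by
    intro X
    induction X using TensorProduct.induction_on with
    | zero => simp
    | add X X' h h' => simp only [map_add, h, h']
    | tmul θ η =>
      rw [TensorProduct.map_tmul, Algebra.TensorProduct.one_def, innerProduct_tmul,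
        innerProduct_tmul, ← formInner_mul, ← formInner_mul, mul_one, mul_one]
  have hc : ∀ X, contraction V (T X) = T (contraction V X) := by
    intro X
    induction X using TensorProduct.induction_on with
    | zero => simp
    | add X X' h h' => simp only [map_add, h, h']
    | tmul θ η =>
      rw [TensorProduct.map_tmul, contraction_tmul (stdOrthonormalBasis ℝ V),
        contraction_tmul (stdOrthonormalBasis ℝ V), map_sum]
      refine Finset.sum_congr rfl fun i _ => ?_
      -- x and y have the same degree s, so the two signs (-1)^s cancel and T commutes with c.
      rw [TensorProduct.map_tmul, interior_interiorForm, interior_interiorForm,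
        gradeInvolution_of_mem hx, gradeInvolution_of_mem hy, map_smul, map_smul,
        LinearMap.smul_apply, LinearMap.smul_apply, TensorProduct.smul_tmul_smul, ← mul_pow]
      simp
  have hcr : ∀ X, (contraction V ^ r) (T X) = T ((contraction V ^ r) X) := by
    intro X
    have : Commute (contraction V) T := LinearMap.ext hc
    exact LinearMap.congr_fun (this.pow_left r) X
  rw [← innerProduct_one_contraction_pow_tmul (interiorForm_mem hx hα), ← hT, ← hcr,
    TensorProduct.map_tmul]

/-- The full contraction of a product of two double forms in terms of their contractions. -/
theorem pairing_mul_comm {P : ℕ} {X Y : DoubleForm V} (hX : X ∈ bidegree V P P)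
    (hY : Y ∈ bidegree V P P) :
    pairing (X * TensorProduct.comm ℝ (Forms V) (Forms V) Y) = ∑ r ∈ Finset.range (P + 1),
      (-1 : ℝ) ^ (r + P) / ((r.factorial : ℝ) ^ 2) *
        innerProduct V ((contraction V ^ r) X) ((contraction V ^ r) Y) := by
  refine bidegree_induction (P := fun X =>
    pairing (X * TensorProduct.comm ℝ (Forms V) (Forms V) Y) = ∑ r ∈ Finset.range (P + 1),
      (-1 : ℝ) ^ (r + P) / ((r.factorial : ℝ) ^ 2) *
        innerProduct V ((contraction V ^ r) X) ((contraction V ^ r) Y)) ?_ ?_ ?_ hX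
  · simp
  · intro X X' h h'
    simp only [add_mul, map_add, h, h', LinearMap.add_apply, mul_add, Finset.sum_add_distrib]
  intro α hα β hβ
  refine bidegree_induction (P := fun Y =>
    pairing (α ⊗ₜ β * TensorProduct.comm ℝ (Forms V) (Forms V) Y) =
      ∑ r ∈ Finset.range (P + 1), (-1 : ℝ) ^ (r + P) / ((r.factorial : ℝ) ^ 2) *
        innerProduct V ((contraction V ^ r) (α ⊗ₜ β)) ((contraction V ^ r) Y)) ?_ ?_ ?_ hY
  · simp
  · intro X X' h h'
    simp only [mul_add, map_add, h, h', Finset.sum_add_distrib]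
  -- With Y = β' ⊗ α' the transpose is α' ⊗ β', so the pairing is ⟨α ∧ α', β ∧ β'⟩.
  intro β' hβ' α' hα'
  rw [TensorProduct.comm_tmul, Algebra.TensorProduct.tmul_mul_tmul, pairing_tmul, formInner_comm,
    formInner_mul, interiorForm_mul_eq_sum hα (gradeInvolution_of_mem hβ) (Nat.lt_succ_self P),
    map_sum]
  refine Finset.sum_congr rfl fun r hr => ?_
  have hrP : r ≤ P := Nat.lt_succ_iff.mp (Finset.mem_range.mp hr)
  -- For Z = x ⊗ y, ⟨β', x ∧ ι_y α'⟩ = ⟨ι_x β', ι_y α'⟩, which a contraction of β' ⊗ α' computes up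
  -- to r!.
  have key : ∀ Z ∈ bidegree V (P - r) (P - r), (r.factorial : ℝ) *
      formInner V β' (mulInterior α' Z) =
        innerProduct V Z ((contraction V ^ r) (β' ⊗ₜ α')) := by
    intro Z hZ
    refine bidegree_induction (P := fun Z => (r.factorial : ℝ) *
      formInner V β' (mulInterior α' Z) =
        innerProduct V Z ((contraction V ^ r) (β' ⊗ₜ α'))) ?_ ?_ ?_ hZ
    · simp
    · intro Z Z' h h'
      simp only [map_add, mul_add, h, h', LinearMap.add_apply]
    · intro x hx y hy
      rw [← Nat.sub_add_cancel hrP] at hβ'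
      rw [← formInner_interiorForm_interiorForm hx hy hβ', mulInterior_tmul, formInner_comm,
        formInner_mul, formInner_comm]
  have sign : (-1 : ℝ) ^ ((P + r) * (P + r)) = (-1) ^ (r + P) := by
    rw [pow_mul, add_comm r P]
    rcases neg_one_pow_eq_or ℝ (P + r) with h | h
    · rw [h, one_pow]
    · rw [h]; exact h
  rw [map_smul, smul_eq_mul, ← key _ (contraction_pow_mem_bidegree
    (tmul_mem_bidegree hα hβ) r), sign]
  field_simp

/-! ### The Hodge star operator -/

section HodgeStar

variable {n : ℕ} (e : OrthonormalBasis (Fin n) ℝ V)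

theorem volumeForm_mem : volumeForm e ∈ ⋀[ℝ]^n (Module.Dual ℝ V) :=
  ExteriorAlgebra.ιMulti_range ℝ n ⟨_, rfl⟩

theorem ι_mul_volumeForm (f : Module.Dual ℝ V) : ExteriorAlgebra.ι ℝ f * volumeForm e = 0 := by
  have h : ExteriorAlgebra.ι ℝ f * volumeForm e = ExteriorAlgebra.ιMulti ℝ (n + 1)
      (Fin.cons f fun i => innerₗ V (e i) : Fin (n + 1) → Module.Dual ℝ V) := by
    rw [ExteriorAlgebra.ιMulti_succ_apply]; rfl
  rw [h]
  refine AlternatingMap.map_linearDependent _ _ fun h => ?_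
  have h2 := h.fintype_card_le_finrank
  have h3 := Module.finrank_eq_card_basis e.toBasis
  rw [Subspace.dual_finrank_eq] at h2
  simp at h2 h3
  omega

/-- Only the degree-zero part of x survives, as one-forms annihilate the volume form. -/
theorem mul_volumeForm (x : Forms V) :
    x * volumeForm e = formInner V 1 x • volumeForm e := by
  induction x using forms_induction_left with
  | algebraMap r =>
    rw [formInner_one, ExteriorAlgebra.algebraMap_leftInverse, Algebra.smul_def]
  | add x y hx hy => rw [add_mul, hx, hy, map_add, add_smul]
  | ι_mul x f h =>
    rw [mul_assoc, h, mul_smul_comm, ι_mul_volumeForm, smul_zero, formInner_comm, formInner_ι_mul,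
      interior_one, map_zero, zero_smul]

theorem formInner_volumeForm : formInner V (volumeForm e) (volumeForm e) = 1 := by
  have h : ∀ i, sharp V (innerₗ V (e i)) = e i := fun i =>
    ext_inner_right ℝ fun v => by rw [inner_sharp, innerₗ_apply_apply]
  rw [volumeForm, formInner_ιMulti_self]
  have : (Matrix.of fun i j => innerₗ V (e i) (sharp V (innerₗ V (e j)))) =
      (1 : Matrix (Fin n) (Fin n) ℝ) := by
    ext i j
    rw [Matrix.of_apply, h, innerₗ_apply_apply, Matrix.one_apply,
      orthonormal_iff_ite.mp e.orthonormal]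
  rw [this, Matrix.det_one]

/-- The Leibniz rule applied to f ∧ vol = 0. -/
theorem ι_mul_formStar (f : Module.Dual ℝ V) (x : Forms V) :
    ExteriorAlgebra.ι ℝ f * formStar e x =
      formStar e (gradeInvolution (interior (sharp V f) x)) := by
  have h := interiorForm_ι_mul (gradeInvolution x) f (volumeForm e)
  have hx : gradeInvolution (gradeInvolution x) = x := CliffordAlgebra.involute_involute x
  rw [ι_mul_volumeForm, map_zero, hx, interior_gradeInvolution, map_neg,
    LinearMap.neg_apply] at h
  rw [formStar_apply, formStar_apply]
  exact (neg_add_eq_zero.mp h.symm).symm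

theorem formInner_gradeInvolution (x y : Forms V) :
    formInner V (gradeInvolution x) y = formInner V x (gradeInvolution y) := by
  have hone : ∀ z : Forms V, formInner V 1 (gradeInvolution z) = formInner V 1 z := by
    intro z
    induction z using forms_induction_left with
    | algebraMap r => rw [AlgHom.commutes]
    | add x y hx hy => simp only [map_add, hx, hy]
    | ι_mul x f h =>
      rw [map_mul, gradeInvolution_ι, neg_mul, map_neg, formInner_comm, formInner_ι_mul,
        formInner_comm 1, formInner_ι_mul, interior_one]
      simp
  have hx : gradeInvolution (gradeInvolution x) = x := CliffordAlgebra.involute_involute x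
  rw [← mul_one (gradeInvolution x), formInner_mul, ← hone, ← interiorForm_gradeInvolution, hx,
    ← formInner_mul, mul_one]

/-- The Hodge star operator is an isometry. -/
theorem formInner_formStar (x y : Forms V) :
    formInner V (formStar e x) (formStar e y) = formInner V x y := by
  -- Right induction fits because *(y ∧ f) = ι_{f♯}(*y); the interior product then moves across as f
  -- ∧ *x, which is again a star.
  induction y using forms_induction_right generalizing x with
  | algebraMap r =>
    rw [Algebra.algebraMap_eq_smul_one, map_smul, map_smul, map_smul, formStar_apply,
      formStar_apply, interiorForm_one, formInner_comm, ← formInner_mul, mul_volumeForm, map_smul,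
      LinearMap.smul_apply, formInner_volumeForm, formInner_comm x]
    simp
  | add y z hy hz => simp only [map_add, hy, hz]
  | mul_ι y f h =>
    rw [formStar_apply e (y * _), interiorForm_mul, interiorForm_ι, ← formStar_apply,
      ← formInner_ι_mul, ι_mul_formStar, h, formInner_gradeInvolution, formInner_comm x,
      formInner_mul, formInner_comm, ← mul_one (gradeInvolution y), formInner_mul,
      ← interior_interiorForm, ← formInner_ι_mul, mul_one]

end HodgeStar

/-! ### The double Hodge star and the cofactor transformation. -/

theorem innerProduct_hodgeStar {n : ℕ} (e : OrthonormalBasis (Fin n) ℝ V) (X Y : DoubleForm V) :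
    innerProduct V (hodgeStar V X) Y =
      innerProduct V (X * Y) (volumeForm e ⊗ₜ volumeForm e) := by
  induction X using TensorProduct.induction_on with
  | zero => simp
  | add X X' h h' => simp only [add_mul, map_add, LinearMap.add_apply, h, h']
  | tmul θ η =>
    induction Y using TensorProduct.induction_on with
    | zero => simp
    | add X X' h h' => simp only [mul_add, map_add, LinearMap.add_apply, h, h']
    | tmul θ' η' =>
      rw [hodgeStar_eq e, TensorProduct.map_tmul, Algebra.TensorProduct.tmul_mul_tmul,
        innerProduct_tmul, innerProduct_tmul, formStar_apply, formStar_apply, formInner_mul,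
        formInner_mul, formInner_comm θ', formInner_comm η']

/-- For X = x ⊗ y the left side is k!⟨ι_x vol, ι_y vol⟩ = k!⟨*x, *y⟩, and the star is an isometry.
-/
theorem innerProduct_contraction_pow_volumeForm {n m k : ℕ} (e : OrthonormalBasis (Fin n) ℝ V)
    (hn : m + k = n) {X : DoubleForm V} (hX : X ∈ bidegree V m m) :
    innerProduct V X ((contraction V ^ k) (volumeForm e ⊗ₜ volumeForm e)) =
      (k.factorial : ℝ) * pairing X := by
  refine bidegree_induction (P := fun X =>
    innerProduct V X ((contraction V ^ k) (volumeForm e ⊗ₜ volumeForm e)) =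
      (k.factorial : ℝ) * pairing X) ?_ ?_ ?_ hX
  · simp
  · intro X Y h h'; simp only [map_add, LinearMap.add_apply, h, h', mul_add]
  · intro x hx y hy
    have hv := volumeForm_mem e
    rw [← formInner_interiorForm_interiorForm hx hy (hn ▸ hv), pairing_tmul,
      ← formInner_formStar e x y, formStar_apply, formStar_apply]

theorem innerProduct_cofactor {p q : ℕ} (hn : 2 * p * q ≤ Module.finrank ℝ V) {ω : DoubleForm V}
    (hω : ω ∈ bidegree V p p) :
    innerProduct V (cofactor (p * q) p q ω) (ω ^ q) = pairing (ω ^ q * ω ^ q) := by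
  have h : ω ^ q * ω ^ q ∈ bidegree V (p * q + p * q) (p * q + p * q) :=
    mul_mem_bidegree (pow_mem_bidegree hω q) (pow_mem_bidegree hω q)
  have hn' : p * q + p * q + (Module.finrank ℝ V - p * q - p * q) = Module.finrank ℝ V := by
    have : 2 * p * q = p * q + p * q := by ring
    omega
  -- Here k = n - 2pq, and k! cancels the normalization of the cofactor.
  rw [cofactor, map_smul, LinearMap.smul_apply, innerProduct_hodgeStar (stdOrthonormalBasis ℝ V),
    mul_assoc, innerProduct_metric_pow_mul,
    innerProduct_contraction_pow_volumeForm _ hn' h, smul_eq_mul, inv_mul_cancel_left₀]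
  exact_mod_cast Nat.factorial_ne_zero _

theorem IsSymmetric.pow {ω : DoubleForm V} (hω : IsSymmetric ω) (q : ℕ) : IsSymmetric (ω ^ q) := by
  have h := map_pow (Algebra.TensorProduct.comm ℝ (Forms V) (Forms V)) ω q
  have h1 : Algebra.TensorProduct.comm ℝ (Forms V) (Forms V) ω = ω := hω
  rw [h1] at h
  exact h

end DoubleForm
end

theorem mainTheorem7 {V : Type*} [NormedAddCommGroup V] [InnerProductSpace ℝ V]
    [FiniteDimensional ℝ V] (p q : ℕ) (hq : 0 < q) (hn : 2 * p * q ≤ Module.finrank ℝ V)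
    (ω : DoubleForm V) (hω : ω ∈ DoubleForm.bidegree V p p)
    (hsymm : DoubleForm.IsSymmetric ω) (hBianchi : DoubleForm.FirstBianchi p p ω) :
    ((2 * p * q).factorial : ℝ)⁻¹ • (DoubleForm.contraction V ^ (2 * p * q)) (ω ^ (2 * q)) =
        algebraMap ℝ (DoubleForm V)
          (DoubleForm.innerProduct V (DoubleForm.cofactor (p * q) p q ω) (ω ^ q)) ∧
      DoubleForm.innerProduct V (DoubleForm.cofactor (p * q) p q ω) (ω ^ q) =
        ∑ r ∈ Finset.range (p * q + 1),
          (-1 : ℝ) ^ (r + p * q) / ((r.factorial : ℝ) ^ 2) *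
            DoubleForm.innerProduct V ((DoubleForm.contraction V ^ r) (ω ^ q))
              ((DoubleForm.contraction V ^ r) (ω ^ q)) := by
  have hpow := DoubleForm.pow_mem_bidegree hω q
  rw [DoubleForm.innerProduct_cofactor hn hω]
  constructor
  · have h := DoubleForm.mul_mem_bidegree hpow hpow
    rw [← two_mul, ← mul_assoc] at h
    rw [two_mul q, pow_add, DoubleForm.contraction_pow_eq_algebraMap h, map_mul,
      ← Algebra.smul_def, inv_smul_smul₀]
    exact_mod_cast Nat.factorial_ne_zero _
  -- Symmetry removes the transpose from the second factor.
  · rw [← DoubleForm.pairing_mul_comm hpow hpow, hsymm.pow q]
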